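/- A \emph{cone} is a commutative monoid $C$ with a scalar multiplication $\mathbb R_+\times C\to C$, $\mathbb R_+=[0,\infty)$, satisfying $r(x+y)=rx+ry$, $(r+s)x=rx+sx$, $(rs)x=r(sx)$, $1x=x$, $0x=0$ and $r0=0$. A \emph{topological cone} is a cone with a $T_0$ topology for which addition $C\times C\to C$ and scalar multiplication $\mathbb R_+\times C\to C$ are jointly continuous, where $\mathbb R_+$ carries the Scott topology (whose open sets are $\emptyset$, $\mathbb R_+$ and the rays $(r,\infty)$, $r\ge 0$). A subset $A$ of a cone is \emph{convex} if $ra+(1-r)b\in A$ for all $a,b\in A$ and $r\in[0,1]$, and a \emph{half-space} if both $A$ and its complement are convex. A topological cone is \emph{weakly locally convex} if every open neighbourhood of each point $x$ contains a convex (not necessarily open) neighbourhood of $x$, and \emph{locally linear} if its topology has a subbase of open half-spaces. A space is \emph{sober} if every irreducible closed subset is the closure of a unique point. A topological cone $C$ is a \emph{continuous linear retract} of a topological cone $D$ if there are a continuous linear map $r\colon D\to C$ and a continuous map $s\colon C\to D$, not necessarily linear, with $r\circ s=\mathrm{id}_C$. Let $C$ be a topological cone. 1. $C$ is weakly locally convex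 if and only if it is a continuous linear retract of some locally linear topological cone. 2. $C$ is weakly locally convex and sober if and only if it is a continuous linear retract of some locally linear sober topological cone. -/

import Mathlib

open scoped NNReal Topology

universe u

/-- A *topological cone*: a cone (a commutative monoid with a scalar multiplication by `ℝ≥0`
satisfying the module axioms) with a `T₀` topology that makes addition and scalar multiplication
jointly continuous. The scalars carry the Scott topology, whose open sets are `∅`, `ℝ≥0` and the
rays `(r, ∞)`; this is the upper topology of the linear order `ℝ≥0`, and `Topology.WithUpper ℝ≥0`
is the type `ℝ≥0` with that topology (instead of the metric one). -/
structure IsTopologicalCone (C : Type u) [AddCommMonoid C] [Module ℝ≥0 C] [TopologicalSpace C] :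
    Prop where
  t0 : T0Space C
  continuous_add : Continuous fun p : C × C => p.1 + p.2
  continuous_smul :
    Continuous fun p : Topology.WithUpper ℝ≥0 × C => Topology.WithUpper.ofUpper p.1 • p.2

/-- A *half-space* of a cone: a convex subset whose complement is convex. -/
def IsHalfSpace {C : Type u} [AddCommMonoid C] [Module ℝ≥0 C] (A : Set C) : Prop :=
  Convex ℝ≥0 A ∧ Convex ℝ≥0 Aᶜ

/-- Every open neighbourhood of a point contains a convex, not necessarily open, neighbourhood of
that point. -/
def IsWeaklyLocallyConvex (C : Type u) [AddCommMonoid C] [Module ℝ≥0 C] [TopologicalSpace C] :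
    Prop :=
  ∀ (x : C) (U : Set C), IsOpen U → x ∈ U → ∃ A : Set C, A ⊆ U ∧ A ∈ 𝓝 x ∧ Convex ℝ≥0 A

/-- The topology has a subbase of open half-spaces. -/
def IsLocallyLinear (C : Type u) [AddCommMonoid C] [Module ℝ≥0 C] [t : TopologicalSpace C] :
    Prop :=
  ∃ S : Set (Set C), (∀ A ∈ S, IsOpen A ∧ IsHalfSpace A) ∧ t = TopologicalSpace.generateFrom S

/-- Every irreducible closed subset is the closure of a unique point. -/
def IsSober (X : Type u) [TopologicalSpace X] : Prop :=
  T0Space X ∧ QuasiSober X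

/-- `C` is a *continuous linear retract* of `D`: there is a continuous linear map `r : D → C` with
a continuous section `s : C → D`; the section need not be linear. -/
def IsContinuousLinearRetract (C : Type u) [AddCommMonoid C] [Module ℝ≥0 C] [TopologicalSpace C]
    (D : Type u) [AddCommMonoid D] [Module ℝ≥0 D] [TopologicalSpace D] : Prop :=
  ∃ (r : D →ₗ[ℝ≥0] C) (s : C → D), Continuous r ∧ Continuous s ∧ ∀ x : C, r (s x) = x

/-! If `C` is weakly locally convex, take for `D` the cone of simple valuations on `C`: finite
positive combinations of point masses, viewed as functions on open sets and topologised by the sets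
`{ν | r < ν U}`. These are half-spaces because evaluation at `U` is linear. The section is `x ↦ δ_x`
and the retraction is the barycenter map.

The crux is continuity of the barycenter, `exists_isOpen_simpleValuation_mem_iff`. If `μ` strictly
exceeds slightly reduced weights of `ν` on all unions of small neighbourhoods of support points of
`ν`, Hall's theorem transports the mass of `μ` to these points. Mass arriving at `x` lies in a
convex neighbourhood of `x`, so it sums to a multiple of a point of it; surplus mass is harmless
since open sets absorb addition.

In the sober case `D` is enlarged to its Skula closure, which is sober. There the barycenter of `y`
is the generic point supplied by the irreducible set of barycenters of simple valuations below `y`.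

Conversely, a linear retraction carries convex open sets to convex neighbourhoods, and sobriety
passes to retracts. -/

/-! ### Fractional transport. -/

/-- A fractional form of Hall's marriage theorem: if every nonempty set of demands is strictly
exceeded by the supply available to it, then all demands can be met. -/
theorem exists_transport {α β : Type*} [DecidableEq α] [DecidableEq β] (I : Finset α)
    (S : Finset β) (R : α → β → Prop) (d : α → ℝ≥0) (m : β → ℝ≥0)
    (h : ∀ J ⊆ I, J.Nonempty →
      ∑ x ∈ J, d x < ∑ y ∈ S, open Classical in if ∃ x ∈ J, R x y then m y else 0) :
    ∃ w : α → β → ℝ≥0, (∀ x y, w x y ≠ 0 → R x y) ∧ (∀ x ∈ I, d x ≤ ∑ y ∈ S, w x y) ∧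
      ∀ y ∈ S, ∑ x ∈ I, w x y ≤ m y := by
  classical
  -- `N` is the common denominator. Rounding costs at most one unit per element of `I` and `S`; for
  -- large `N` the strict inequalities absorb this.
  obtain ⟨N, hN0, hN⟩ : ∃ N : ℕ, 0 < N ∧ ∀ J ∈ I.powerset, J.Nonempty →
      ∑ x ∈ J, (d x : ℝ) + (I.card + S.card : ℝ) / N <
        ∑ y ∈ S, if ∃ x ∈ J, R x y then (m y : ℝ) else 0 := by
    have key : ∀ᶠ N : ℕ in Filter.atTop, ∀ J ∈ I.powerset, J.Nonempty →
        ∑ x ∈ J, (d x : ℝ) + (I.card + S.card : ℝ) / N <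
          ∑ y ∈ S, if ∃ x ∈ J, R x y then (m y : ℝ) else 0 := by
      rw [Filter.eventually_all_finset]
      intro J hJ
      by_cases hne : J.Nonempty
      · have hlt : ∑ x ∈ J, (d x : ℝ) + 0 < ∑ y ∈ S, if ∃ x ∈ J, R x y then (m y : ℝ) else 0 := by
          have := NNReal.coe_lt_coe.2 (h J (Finset.mem_powerset.1 hJ) hne)
          push_cast at this
          simpa [apply_ite] using this
        have ht : Filter.Tendsto
            (fun N : ℕ => ∑ x ∈ J, (d x : ℝ) + (I.card + S.card : ℝ) / N)
            Filter.atTop (𝓝 (∑ x ∈ J, (d x : ℝ) + 0)) :=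
          tendsto_const_nhds.add (tendsto_const_div_atTop_nhds_zero_nat _)
        filter_upwards [ht.eventually_lt_const hlt] with N hN _ using hN
      · exact Filter.Eventually.of_forall fun _ h => absurd h hne
    obtain ⟨N, h1, h2⟩ := (key.and (Filter.eventually_gt_atTop 0)).exists
    exact ⟨N, h2, h1⟩
  have hNr : (0 : ℝ) < N := by exact_mod_cast hN0
  have hNn : (0 : ℝ≥0) < N := by exact_mod_cast hN0
  -- units of demand and of supply
  let U : α → ℕ := fun x => ⌈N * d x⌉₊
  let M : β → ℕ := fun y => ⌊N * m y⌋₊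
  let T : (Σ x : I, Fin (U x)) → Finset (Σ _ : β, ℕ) := fun p =>
    (S.filter fun y => R p.1 y).sigma fun y => Finset.range (M y)
  -- Hall's theorem matches each unit of demand to its own unit of admissible supply.
  obtain ⟨f, finj, hf⟩ : ∃ f : (Σ x : I, Fin (U x)) → Σ _ : β, ℕ,
      Function.Injective f ∧ ∀ p, f p ∈ T p := by
    rw [← Finset.all_card_le_biUnion_card_iff_exists_injective]
    intro s
    rcases s.eq_empty_or_nonempty with rfl | hs
    · simp
    let J : Finset α := s.image fun p => (p.1 : α)
    have hJI : J ⊆ I := by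
      intro x hx
      obtain ⟨p, -, rfl⟩ := Finset.mem_image.1 hx
      exact p.1.2
    have hJ := hN J (Finset.mem_powerset.2 hJI) (hs.image _)
    have h1 : s.card ≤ ∑ x ∈ J, U x := by
      have : s.card ≤ (J.sigma fun x => Finset.range (U x)).card := by
        refine Finset.card_le_card_of_injOn (fun p => ⟨(p.1 : α), (p.2 : ℕ)⟩) ?_ ?_
        · intro p hp
          simp only [Finset.coe_sigma, Set.mem_sigma_iff, Finset.mem_coe, Finset.mem_range]
          exact ⟨Finset.mem_image.2 ⟨p, hp, rfl⟩, p.2.2⟩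
        · rintro ⟨⟨x, hx⟩, k⟩ - ⟨⟨x', hx'⟩, k'⟩ - hxx
          simp only [Sigma.mk.injEq] at hxx
          obtain ⟨rfl, hk⟩ := hxx
          have : k = k' := Fin.ext (eq_of_heq hk)
          rw [this]
      simpa using this
    have h2 : (S.filter fun y => ∃ x ∈ J, R x y).sigma (fun y => Finset.range (M y)) ⊆
        s.biUnion T := by
      rintro ⟨y, k⟩ hyk
      simp only [Finset.mem_sigma, Finset.mem_filter] at hyk
      obtain ⟨⟨hy, x, hx, hR⟩, hk⟩ := hyk
      obtain ⟨p, hp, rfl⟩ := Finset.mem_image.1 hx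
      exact Finset.mem_biUnion.2 ⟨p, hp, by simp [T, hy, hR, Finset.mem_range.1 hk]⟩
    have h3 := Finset.card_le_card h2
    rw [Finset.card_sigma] at h3
    simp only [Finset.card_range] at h3
    refine h1.trans (le_trans ?_ h3)
    have e1 : (∑ x ∈ J, (U x : ℝ)) ≤ N * ∑ x ∈ J, (d x : ℝ) + I.card := by
      calc (∑ x ∈ J, (U x : ℝ)) ≤ ∑ x ∈ J, (N * (d x : ℝ) + 1) := by
            refine Finset.sum_le_sum fun x _ => ?_
            have := (Nat.ceil_lt_add_one (zero_le : 0 ≤ (N * d x : ℝ≥0))).le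
            have := NNReal.coe_le_coe.2 this
            push_cast at this
            exact this
        _ = N * ∑ x ∈ J, (d x : ℝ) + J.card := by
            rw [Finset.sum_add_distrib, Finset.mul_sum]; simp
        _ ≤ _ := by
            have : (J.card : ℝ) ≤ I.card := by exact_mod_cast Finset.card_le_card hJI
            linarith
    have e2 : N * (∑ y ∈ S, if ∃ x ∈ J, R x y then (m y : ℝ) else 0) - S.card ≤
        ∑ y ∈ S with ∃ x ∈ J, R x y, (M y : ℝ) := by
      rw [Finset.sum_filter, Finset.mul_sum]
      have : ((S.card : ℝ)) = ∑ y ∈ S, (1 : ℝ) := by simp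
      rw [this, ← Finset.sum_sub_distrib]
      refine Finset.sum_le_sum fun y _ => ?_
      split_ifs
      · have := (Nat.lt_floor_add_one (N * m y : ℝ≥0)).le
        have := NNReal.coe_le_coe.2 this
        push_cast at this
        simp only [M]
        linarith
      · simp
    have e3 : N * ∑ x ∈ J, (d x : ℝ) + (I.card + S.card : ℝ) ≤
        N * (∑ y ∈ S, if ∃ x ∈ J, R x y then (m y : ℝ) else 0) := by
      have := mul_le_mul_of_nonneg_left hJ.le hNr.le
      rwa [mul_add, mul_div_cancel₀ _ hNr.ne'] at this
    have : (∑ x ∈ J, (U x : ℝ)) ≤ ∑ y ∈ S with ∃ x ∈ J, R x y, (M y : ℝ) := by linarith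
    exact_mod_cast this
  -- `c x y` counts the units of demand at `x` served from `y`.
  let c : α → β → ℕ := fun x y =>
    if hx : x ∈ I then (Finset.univ.filter fun k : Fin (U x) => (f ⟨⟨x, hx⟩, k⟩).1 = y).card else 0
  refine ⟨fun x y => c x y / N, ?_, ?_, ?_⟩
  · intro x y hxy
    have hc : c x y ≠ 0 := by rintro h0; simp [h0] at hxy
    by_cases hx : x ∈ I
    · simp only [c, hx, dif_pos] at hc
      obtain ⟨k, hk⟩ := Finset.card_ne_zero.1 hc
      have hk := (Finset.mem_filter.1 hk).2
      have := hf ⟨⟨x, hx⟩, k⟩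
      simp only [T, Finset.mem_sigma, Finset.mem_filter] at this
      rw [← hk]
      exact this.1.2
    · simp [c, hx] at hc
  · intro x hx
    rw [← Finset.sum_div, le_div_iff₀ hNn]
    have : ∑ y ∈ S, c x y = U x := by
      simp only [c, hx, dif_pos]
      rw [← Finset.card_eq_sum_card_fiberwise]
      · simp
      · intro k _
        have := hf ⟨⟨x, hx⟩, k⟩
        simp only [T, Finset.mem_sigma, Finset.mem_filter] at this
        exact this.1.1
    rw [← Nat.cast_sum, this, mul_comm]
    exact Nat.le_ceil _
  · intro y hy
    rw [← Finset.sum_div, div_le_iff₀ hNn]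
    have : ∑ x ∈ I, c x y ≤ M y := by
      rw [← Finset.sum_coe_sort]
      have : ∀ x : I, c x y =
          (Finset.univ.filter fun k : Fin (U x) => (f ⟨x, k⟩).1 = y).card := by
        intro x; simp [c]
      simp_rw [this]
      rw [← Finset.card_sigma]
      rw [← Finset.card_range (M y)]
      refine Finset.card_le_card_of_injOn (fun p => (f ⟨p.1, p.2⟩).2) ?_ ?_
      · rintro ⟨x, k⟩ hp
        simp only [Finset.coe_sigma, Set.mem_sigma_iff, Finset.mem_coe, Finset.mem_filter] at hp
        have := hf ⟨x, k⟩
        simp only [T, Finset.mem_sigma, Finset.mem_filter] at this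
        rw [← hp.2.2]
        exact this.2
      · rintro ⟨x, k⟩ hp ⟨x', k'⟩ hp' hh
        simp only [Finset.coe_sigma, Set.mem_sigma_iff, Finset.mem_coe, Finset.mem_filter] at hp hp'
        exact finj (Sigma.ext (hp.2.2.trans hp'.2.2.symm) (heq_of_eq hh))
    rw [← Nat.cast_sum]
    calc ((∑ x ∈ I, c x y : ℕ) : ℝ≥0) ≤ M y := by exact_mod_cast this
      _ ≤ N * m y := Nat.floor_le zero_le
      _ = _ := mul_comm _ _

/-! ### Linear combinations in topological cones. -/

theorem Topology.WithUpper.exists_lt_of_isOpen {U : Set (Topology.WithUpper ℝ≥0)} (hU : IsOpen U)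
    {a : ℝ≥0} (ha : Topology.WithUpper.toUpper a ∈ U) (ha0 : 0 < a) :
    ∃ r < a, ∀ t, r < t → Topology.WithUpper.toUpper t ∈ U := by
  obtain ⟨W, hW, haW, hWU⟩ :=
    Topology.IsUpper.isTopologicalBasis_insert_univ_subbasis.exists_subset_of_mem_open ha hU
  rcases hW with rfl | ⟨r, rfl⟩
  · exact ⟨0, ha0, fun _ _ => hWU trivial⟩
  · exact ⟨Topology.WithUpper.ofUpper r, lt_of_not_ge fun h => haW h,
      fun t ht => hWU fun h => ht.not_ge h⟩

/-- A convex set absorbs finite sums of positive multiples of its elements up to scaling. -/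
theorem Convex.sum_smul_eq_smul {C ι : Type*} [AddCommMonoid C] [Module ℝ≥0 C] {A : Set C}
    (hA : Convex ℝ≥0 A) (S : Finset ι) (w : ι → ℝ≥0) (z : ι → C)
    (h : ∀ i ∈ S, w i ≠ 0 → z i ∈ A) (hpos : 0 < ∑ i ∈ S, w i) :
    ∃ a ∈ A, ∑ i ∈ S, w i • z i = (∑ i ∈ S, w i) • a := by
  classical
  induction S using Finset.induction_on with
  | empty => simp at hpos
  | insert i S hi ih =>
    rw [Finset.sum_insert hi] at hpos
    rw [Finset.sum_insert hi, Finset.sum_insert hi]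
    by_cases hS : ∑ j ∈ S, w j = 0
    · have h0 : ∀ j ∈ S, w j = 0 := by simpa using hS
      have h1 : ∑ j ∈ S, w j • z j = 0 :=
        Finset.sum_eq_zero fun j hj => by rw [h0 j hj, zero_smul]
      rw [hS, add_zero] at hpos
      exact ⟨z i, h i (Finset.mem_insert_self _ _) hpos.ne', by rw [h1, hS, add_zero, add_zero]⟩
    · obtain ⟨a, ha, hEq⟩ := ih (fun j hj => h j (Finset.mem_insert_of_mem hj))
        (pos_iff_ne_zero.2 hS)
      rw [hEq]
      by_cases hwi : w i = 0
      · exact ⟨a, ha, by simp [hwi]⟩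
      · set s := ∑ j ∈ S, w j
        refine ⟨(w i / (w i + s)) • z i + (s / (w i + s)) • a,
          hA (h i (Finset.mem_insert_self _ _) hwi) ha zero_le zero_le ?_, ?_⟩
        · rw [← add_div, div_self hpos.ne']
        · rw [smul_add, smul_smul, smul_smul, mul_div_cancel₀ _ hpos.ne',
            mul_div_cancel₀ _ hpos.ne']

namespace IsTopologicalCone

variable {C : Type u} [AddCommMonoid C] [Module ℝ≥0 C] [TopologicalSpace C]

/-- Open sets of a topological cone absorb addition. -/
theorem add_mem_of_isOpen (hC : IsTopologicalCone C) {V : Set C} (hV : IsOpen V) {c : C}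
    (hc : c ∈ V) (d : C) : c + d ∈ V := by
  -- The preimage of `V` under `t ↦ c + t • d` is an upper set containing `0`, hence `1`.
  have hcont : Continuous fun t : Topology.WithUpper ℝ≥0 =>
      c + Topology.WithUpper.ofUpper t • d :=
    hC.continuous_add.comp (continuous_const.prodMk
      (hC.continuous_smul.comp (continuous_id.prodMk continuous_const)))
  have := Topology.IsUpper.isUpperSet_of_isOpen (hV.preimage hcont)
    (show Topology.WithUpper.toUpper (0 : ℝ≥0) ≤ Topology.WithUpper.toUpper 1 by simp)
    (by simpa using hc)
  simpa using this

/-- Joint continuity of finite linear combinations with positive coefficients. -/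
theorem exists_nhds_sum_smul_mem (hC : IsTopologicalCone C) (I : Finset C) (a : C → ℝ≥0)
    (ha : ∀ x ∈ I, 0 < a x) {V : Set C} (hV : IsOpen V) (hmem : ∑ x ∈ I, a x • x ∈ V) :
    ∃ (r : C → ℝ≥0) (O : C → Set C), (∀ x ∈ I, r x < a x ∧ IsOpen (O x) ∧ x ∈ O x) ∧
      ∀ (t : C → ℝ≥0) (y : C → C), (∀ x ∈ I, r x < t x ∧ y x ∈ O x) →
        ∑ x ∈ I, t x • y x ∈ V := by
  classical
  induction I using Finset.induction_on generalizing V with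
  | empty => exact ⟨0, fun _ => Set.univ, by simp, by simpa using hmem⟩
  | insert i I hi ih =>
    rw [Finset.sum_insert hi] at hmem
    obtain ⟨V₁, V₂, hV₁, hV₂, h₁, h₂, hsub⟩ :=
      isOpen_prod_iff.1 (hV.preimage hC.continuous_add) _ _ hmem
    obtain ⟨W, O, hW, hO, hWa, hOi, hsub'⟩ :=
      isOpen_prod_iff.1 (hV₁.preimage hC.continuous_smul) (Topology.WithUpper.toUpper (a i)) i h₁
    obtain ⟨r₀, hr₀, hr₀W⟩ :=
      Topology.WithUpper.exists_lt_of_isOpen hW hWa (ha i (Finset.mem_insert_self _ _))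
    obtain ⟨r, P, hrP, hall⟩ := ih (fun x hx => ha x (Finset.mem_insert_of_mem hx)) hV₂ h₂
    have hne : ∀ x ∈ I, x ≠ i := fun x hx h => hi (h ▸ hx)
    refine ⟨Function.update r i r₀, Function.update P i O, ?_, ?_⟩
    · intro x hx
      rcases Finset.mem_insert.1 hx with rfl | hx
      · simpa using ⟨hr₀, hO, hOi⟩
      · simpa [Function.update_of_ne (hne x hx)] using hrP x hx
    · intro t y hty
      rw [Finset.sum_insert hi]
      have hi' := hty i (Finset.mem_insert_self _ _)
      simp only [Function.update_self] at hi'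
      refine hsub (Set.mk_mem_prod ?_ (hall t y fun x hx => ?_))
      · exact hsub' (Set.mk_mem_prod (hr₀W _ hi'.1) hi'.2)
      · simpa [Function.update_of_ne (hne x hx)] using hty x (Finset.mem_insert_of_mem hx)

/-- In a weakly locally convex topological cone, if `∑ a x • x ∈ V`, then every finite linear
combination whose weights nearly dominate those of `a` on suitable neighbourhoods lies in `V`. -/
theorem exists_sum_smul_mem_of_lt (hC : IsTopologicalCone C) (hW : IsWeaklyLocallyConvex C)
    (I : Finset C) (a : C → ℝ≥0) (ha : ∀ x ∈ I, 0 < a x) {V : Set C} (hV : IsOpen V)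
    (hmem : ∑ x ∈ I, a x • x ∈ V) :
    ∃ (r : C → ℝ≥0) (O : C → TopologicalSpace.Opens C), (∀ x ∈ I, r x < a x ∧ x ∈ O x) ∧
      ∀ (S : Finset C) (m : C → ℝ≥0), (∀ J ⊆ I, J.Nonempty →
        ∑ x ∈ J, r x < ∑ y ∈ S, open Classical in if ∃ x ∈ J, y ∈ O x then m y else 0) →
        ∑ y ∈ S, m y • y ∈ V := by
  classical
  obtain ⟨r, O, hrO, hall⟩ := hC.exists_nhds_sum_smul_mem I a ha hV hmem
  -- Transport yields only `r' x ≤` the received mass, while `hall` needs a strict bound; hence the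
  -- intermediate `r'`.
  have hr' : ∀ x, ∃ r', x ∈ I → r x < r' ∧ r' < a x := by
    intro x
    by_cases hx : x ∈ I
    · obtain ⟨s, hs⟩ := exists_between (hrO x hx).1
      exact ⟨s, fun _ => hs⟩
    · exact ⟨0, fun h => absurd h hx⟩
  choose r' hr' using hr'
  have hA : ∀ x, ∃ A : Set C, x ∈ I → A ⊆ O x ∧ A ∈ 𝓝 x ∧ Convex ℝ≥0 A := by
    intro x
    by_cases hx : x ∈ I
    · obtain ⟨A, hA⟩ := hW x (O x) (hrO x hx).2.1 (hrO x hx).2.2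
      exact ⟨A, fun _ => hA⟩
    · exact ⟨∅, fun h => absurd h hx⟩
  choose A hA using hA
  refine ⟨r', fun x => ⟨interior (A x), isOpen_interior⟩, fun x hx => ⟨(hr' x hx).2,
    mem_interior_iff_mem_nhds.2 (hA x hx).2.1⟩, fun S m hm => ?_⟩
  obtain ⟨w, hw, hwr, hwm⟩ := exists_transport I S (fun x y => y ∈ interior (A x)) r' m hm
  have hpos : ∀ x ∈ I, r x < ∑ y ∈ S, w x y := fun x hx => (hr' x hx).1.trans_le (hwr x hx)
  have hc : ∀ x, ∃ c : C, x ∈ I → c ∈ A x ∧ ∑ y ∈ S, w x y • y = (∑ y ∈ S, w x y) • c := by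
    intro x
    by_cases hx : x ∈ I
    · obtain ⟨c, hc⟩ := (hA x hx).2.2.sum_smul_eq_smul S (w x) id
        (fun y _ hy => interior_subset (hw x y hy)) (zero_le.trans_lt (hpos x hx))
      exact ⟨c, fun _ => hc⟩
    · exact ⟨0, fun h => absurd h hx⟩
  choose c hc using hc
  have hmain := hall (fun x => ∑ y ∈ S, w x y) c fun x hx =>
    ⟨hpos x hx, (hA x hx).1 (hc x hx).1⟩
  -- The mass splits into the transported part, regrouped by target, and the unused surplus.
  have hsum : ∑ y ∈ S, m y • y = ∑ x ∈ I, (∑ y ∈ S, w x y) • c x +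
      ∑ y ∈ S, (m y - ∑ x ∈ I, w x y) • y := by
    have : ∑ x ∈ I, (∑ y ∈ S, w x y) • c x = ∑ y ∈ S, (∑ x ∈ I, w x y) • y := by
      rw [Finset.sum_congr rfl fun x hx => (hc x hx).2.symm, Finset.sum_comm]
      simp_rw [Finset.sum_smul]
    rw [this, ← Finset.sum_add_distrib]
    refine Finset.sum_congr rfl fun y hy => ?_
    rw [← add_smul, add_tsub_cancel_of_le (hwm y hy)]
  rw [hsum]
  exact hC.add_mem_of_isOpen hV hmain _

end IsTopologicalCone

/-! ### The ambient cone of functions and its subcones. -/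

open scoped ENNReal

/-- Families of extended nonnegative reals, with the product of the upper topologies. -/
def UpperPi (ι : Type u) : Type u := ι → ℝ≥0∞

namespace UpperPi

variable {ι : Type u}

noncomputable instance : AddCommMonoid (UpperPi ι) := inferInstanceAs (AddCommMonoid (ι → ℝ≥0∞))

noncomputable instance : Module ℝ≥0 (UpperPi ι) := inferInstanceAs (Module ℝ≥0 (ι → ℝ≥0∞))

instance : PartialOrder (UpperPi ι) := inferInstanceAs (PartialOrder (ι → ℝ≥0∞))

instance : TopologicalSpace (UpperPi ι) :=
  TopologicalSpace.generateFrom {s | ∃ (i : ι) (r : ℝ≥0∞), s = {f | r < f i}}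

theorem isOpen_lt_apply (i : ι) (r : ℝ≥0∞) : IsOpen {f : UpperPi ι | r < f i} :=
  TopologicalSpace.isOpen_generateFrom_of_mem ⟨i, r, rfl⟩

theorem continuous_iff {X : Type*} [TopologicalSpace X] {f : X → UpperPi ι} :
    Continuous f ↔ ∀ (i : ι) (r : ℝ≥0∞), IsOpen {x | r < f x i} := by
  refine continuous_generateFrom_iff.trans ⟨fun h i r => h _ ⟨i, r, rfl⟩, ?_⟩
  rintro h _ ⟨i, r, rfl⟩
  exact h i r

theorem exists_finset_of_isOpen {W : Set (UpperPi ι)} (hW : IsOpen W) {f : UpperPi ι}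
    (hf : f ∈ W) : ∃ F : Set (ι × ℝ≥0∞), F.Finite ∧ (∀ p ∈ F, p.2 < f p.1) ∧
      ∀ g : UpperPi ι, (∀ p ∈ F, p.2 < g p.1) → g ∈ W := by
  induction hW with
  | basic s hs =>
    obtain ⟨i, r, rfl⟩ := hs
    exact ⟨{(i, r)}, Set.finite_singleton _, by simpa using hf, fun g hg => by simpa using hg⟩
  | univ => exact ⟨∅, Set.finite_empty, by simp, fun _ _ => trivial⟩
  | inter s t _ _ ihs iht =>
    obtain ⟨F, hF, hFf, hFs⟩ := ihs hf.1
    obtain ⟨G, hG, hGf, hGt⟩ := iht hf.2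
    exact ⟨F ∪ G, hF.union hG, fun p hp => hp.elim (hFf p) (hGf p), fun g hg =>
      ⟨hFs g fun p hp => hg p (Or.inl hp), hGt g fun p hp => hg p (Or.inr hp)⟩⟩
  | sUnion S _ ih =>
    obtain ⟨s, hs, hfs⟩ := hf
    obtain ⟨F, hF, hFf, hFs⟩ := ih s hs hfs
    exact ⟨F, hF, hFf, fun g hg => ⟨s, hs, hFs g hg⟩⟩

theorem mem_of_le_of_isOpen {W : Set (UpperPi ι)} (hW : IsOpen W) {f g : UpperPi ι}
    (hf : f ∈ W) (hfg : f ≤ g) : g ∈ W := by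
  obtain ⟨F, -, hFf, hFW⟩ := exists_finset_of_isOpen hW hf
  exact hFW g fun p hp => (hFf p hp).trans_le (hfg p.1)

instance : T0Space (UpperPi ι) := by
  refine ⟨fun f g h => funext fun i => ?_⟩
  have key := fun r => h.mem_open_iff (isOpen_lt_apply i r)
  exact eq_of_forall_lt_iff key

theorem continuous_add : Continuous fun p : UpperPi ι × UpperPi ι => p.1 + p.2 := by
  refine continuous_iff.2 fun i r => ?_
  have hl : LowerSemicontinuous fun f : UpperPi ι => f i :=
    lowerSemicontinuous_iff_isOpen_preimage.2 (isOpen_lt_apply i)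
  have h1 : LowerSemicontinuous fun p : UpperPi ι × UpperPi ι => p.1 i :=
    fun p r hr => continuous_fst.continuousAt.eventually (hl p.1 r hr)
  have h2 : LowerSemicontinuous fun p : UpperPi ι × UpperPi ι => p.2 i :=
    fun p r hr => continuous_snd.continuousAt.eventually (hl p.2 r hr)
  exact (h1.add h2).isOpen_preimage r

theorem continuous_smul : Continuous fun p : Topology.WithUpper ℝ≥0 × UpperPi ι =>
    Topology.WithUpper.ofUpper p.1 • p.2 := by
  refine continuous_iff.2 fun i r => isOpen_iff_mem_nhds.2 ?_
  rintro ⟨c, f⟩ hcf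
  change r < ((Topology.WithUpper.ofUpper c : ℝ≥0) : ℝ≥0∞) * f i at hcf
  obtain ⟨b, hb, x, hx, hr⟩ :
      ∃ b < ((Topology.WithUpper.ofUpper c : ℝ≥0) : ℝ≥0∞), ∃ x < f i, r < b * x := by
    contrapose! hcf
    exact ENNReal.mul_le_of_forall_lt hcf
  lift b to ℝ≥0 using hb.ne_top
  replace hb : b < Topology.WithUpper.ofUpper c := by exact_mod_cast hb
  have hopen : IsOpen {t : Topology.WithUpper ℝ≥0 | b < Topology.WithUpper.ofUpper t} := by
    convert! (isClosed_Iic (a := Topology.WithUpper.toUpper b)).isOpen_compl using 1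
    ext t
    exact (not_le (a := Topology.WithUpper.ofUpper t) (b := b)).symm
  filter_upwards [(hopen.prod (isOpen_lt_apply i x)).mem_nhds ⟨hb, hx⟩] with p hp
  exact hr.trans_le (mul_le_mul' (by exact_mod_cast hp.1.le) hp.2.le)

section Submodule

variable (P : Submodule ℝ≥0 (UpperPi ι))

theorem isTopologicalCone_submodule : IsTopologicalCone P where
  t0 := inferInstance
  continuous_add := by
    refine Continuous.subtype_mk (UpperPi.continuous_add.comp
      (f := fun p : P × P => ((p.1 : UpperPi ι), (p.2 : UpperPi ι))) ?_) _
    fun_prop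
  continuous_smul := by
    refine Continuous.subtype_mk (UpperPi.continuous_smul.comp
      (f := fun p : Topology.WithUpper ℝ≥0 × P => (p.1, (p.2 : UpperPi ι))) ?_) _
    fun_prop

theorem isLocallyLinear_submodule : IsLocallyLinear P := by
  refine ⟨Set.preimage Subtype.val '' {s | ∃ (i : ι) (r : ℝ≥0∞), s = {f | r < f i}}, ?_,
    induced_generateFrom_eq⟩
  rintro _ ⟨_, ⟨i, r, rfl⟩, rfl⟩
  have hcomb : ∀ (a b : ℝ≥0), a + b = 1 → ∀ x : ℝ≥0∞, (a : ℝ≥0∞) * x + b * x = x := by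
    intro a b hab x
    rw [← add_mul, ← ENNReal.coe_add, hab, ENNReal.coe_one, one_mul]
  refine ⟨(isOpen_lt_apply i r).preimage continuous_subtype_val, ?_, ?_⟩
  · intro f hf g hg a b _ _ hab
    change r < a * (f : UpperPi ι) i + b * (g : UpperPi ι) i
    refine (lt_min hf hg).trans_le ((hcomb a b hab _).symm.le.trans ?_)
    gcongr
    exacts [min_le_left _ _, min_le_right _ _]
  · intro f hf g hg a b _ _ hab
    replace hf : (f : UpperPi ι) i ≤ r := not_lt.1 hf
    replace hg : (g : UpperPi ι) i ≤ r := not_lt.1 hg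
    change ¬ r < a * (f : UpperPi ι) i + b * (g : UpperPi ι) i
    refine not_lt.2 (le_trans ?_ (hcomb a b hab r).le)
    gcongr

end Submodule

/-! ### Skula closure and sobriety. -/

/-- The closure of a set in the topology generated by the open and the closed sets. -/
def skulaClosure (X : Set (UpperPi ι)) : Set (UpperPi ι) :=
  {f | ∀ W : Set (UpperPi ι), IsOpen W → f ∈ W → ∃ g ∈ X, g ∈ W ∧ g ≤ f}

theorem subset_skulaClosure (X : Set (UpperPi ι)) : X ⊆ skulaClosure X :=
  fun f hf _ _ hfW => ⟨f, hf, hfW, le_rfl⟩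

/-- The Skula closure of a submodule is a submodule. -/
noncomputable def skulaSubmodule (X : Submodule ℝ≥0 (UpperPi ι)) :
    Submodule ℝ≥0 (UpperPi ι) where
  carrier := skulaClosure X
  zero_mem' := subset_skulaClosure _ X.zero_mem
  add_mem' := by
    intro f g hf hg W hW hfg
    obtain ⟨V₁, V₂, hV₁, hV₂, h₁, h₂, hsub⟩ :=
      isOpen_prod_iff.1 (hW.preimage UpperPi.continuous_add) _ _ hfg
    obtain ⟨f', hf', hfV, hff⟩ := hf V₁ hV₁ h₁
    obtain ⟨g', hg', hgV, hgg⟩ := hg V₂ hV₂ h₂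
    exact ⟨f' + g', X.add_mem hf' hg', hsub (Set.mk_mem_prod hfV hgV),
      fun i => add_le_add (hff i) (hgg i)⟩
  smul_mem' := by
    intro c f hf W hW hcf
    have hcont : Continuous fun f : UpperPi ι => c • f :=
      UpperPi.continuous_smul.comp
        (f := fun f : UpperPi ι => (Topology.WithUpper.toUpper c, f)) (by fun_prop)
    obtain ⟨f', hf', hfW, hff⟩ := hf _ (hW.preimage hcont) hcf
    exact ⟨c • f', X.smul_mem c hf', hfW, fun i => mul_le_mul_right (hff i) _⟩

/-- The generic point of an irreducible closed set is its pointwise supremum: irreducibility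
realises finitely many strict lower bounds by a single member, so the supremum stays in the Skula
closure. -/
theorem isSober_skulaClosure (X : Set (UpperPi ι)) : IsSober (skulaClosure X) := by
  refine ⟨inferInstance, ⟨fun {S} hS hSc => ?_⟩⟩
  let y : UpperPi ι := fun i => ⨆ f : S, (f : UpperPi ι) i
  have hle : ∀ f ∈ S, (f : UpperPi ι) ≤ y := fun f hf i =>
    le_iSup (fun f : S => (f : UpperPi ι) i) ⟨f, hf⟩
  have hmeet : ∀ W : Set (UpperPi ι), IsOpen W → y ∈ W → ∃ f ∈ S, (f : UpperPi ι) ∈ W := by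
    intro W hW hy
    obtain ⟨F, hF, hFy, hFW⟩ := exists_finset_of_isOpen hW hy
    suffices h : (S ∩ ⋂ p ∈ F, {f : skulaClosure X | p.2 < (f : UpperPi ι) p.1}).Nonempty by
      obtain ⟨f, hf, hfF⟩ := h
      exact ⟨f, hf, hFW _ fun p hp => by simpa using Set.mem_iInter₂.1 hfF p hp⟩
    clear hFW
    induction F, hF using Set.Finite.induction_on with
    | empty => simpa using hS.nonempty
    | @insert p F _ hF ih =>
      rw [Set.biInter_insert]
      refine hS.isPreirreducible _ _
        ((isOpen_lt_apply p.1 p.2).preimage continuous_subtype_val)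
        (hF.isOpen_biInter fun q _ =>
          (isOpen_lt_apply q.1 q.2).preimage continuous_subtype_val) ?_
        (ih fun q hq => hFy q (Set.mem_insert_of_mem _ hq))
      obtain ⟨f, hf⟩ := lt_iSup_iff.1 (hFy p (Set.mem_insert _ _))
      exact ⟨f, f.2, hf⟩
  have hyX : y ∈ skulaClosure X := by
    intro W hW hy
    obtain ⟨f, hf, hfW⟩ := hmeet W hW hy
    obtain ⟨g, hg, hgW, hgf⟩ := f.2 W hW hfW
    exact ⟨g, hg, hgW, hgf.trans (hle f hf)⟩
  refine ⟨⟨y, hyX⟩, Set.Subset.antisymm (closure_minimal ?_ hSc) fun f hf => ?_⟩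
  · rw [Set.singleton_subset_iff, ← hSc.closure_eq, mem_closure_iff]
    rintro _ ⟨W, hW, rfl⟩ hy
    obtain ⟨f, hf, hfW⟩ := hmeet W hW hy
    exact ⟨f, hfW, hf⟩
  · rw [mem_closure_iff]
    rintro _ ⟨W, hW, rfl⟩ hfW
    exact ⟨_, mem_of_le_of_isOpen hW hfW (hle f hf), rfl⟩

end UpperPi

/-! ### Simple valuations and the barycenter map. -/

open scoped ENNReal
open TopologicalSpace (Opens)

section SimpleValuation

variable (C : Type u) [TopologicalSpace C]

/-- The point mass at `x`, as a function on open sets. -/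
noncomputable def diracValuation (x : C) : UpperPi (Opens C) :=
  fun U => open Classical in if x ∈ U then 1 else 0

/-- The simple valuation `U ↦ ∑ {a x | x ∈ U}` on open sets given by finitely many weights. -/
noncomputable def simpleValuation : (C →₀ ℝ≥0) →ₗ[ℝ≥0] UpperPi (Opens C) :=
  Finsupp.linearCombination ℝ≥0 (diracValuation C)

variable {C}

open Classical in
theorem simpleValuation_apply (ν : C →₀ ℝ≥0) (U : Opens C) :
    simpleValuation C ν U = ((∑ y ∈ ν.support, if y ∈ U then ν y else 0 : ℝ≥0) : ℝ≥0∞) := by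
  let ev : UpperPi (Opens C) →+ ℝ≥0∞ := ⟨⟨fun f => f U, rfl⟩, fun _ _ => rfl⟩
  change ev (simpleValuation C ν) = _
  rw [simpleValuation, Finsupp.linearCombination_apply, Finsupp.sum, map_sum,
    ENNReal.ofNNReal_finsetSum]
  refine Finset.sum_congr rfl fun y _ => ?_
  change (ν y : ℝ≥0∞) * (if y ∈ U then 1 else 0) = _
  split_ifs <;> simp

open Classical in
theorem simpleValuation_single_apply (x : C) (U : Opens C) :
    simpleValuation C (Finsupp.single x 1) U = if x ∈ U then 1 else 0 := by
  rw [simpleValuation, Finsupp.linearCombination_single, one_smul, diracValuation]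

end SimpleValuation

section Barycenter

variable (C : Type u) [AddCommMonoid C] [Module ℝ≥0 C]

/-- The linear map sending a finitely supported weight to its barycenter. -/
noncomputable def barycenter : (C →₀ ℝ≥0) →ₗ[ℝ≥0] C := Finsupp.linearCombination ℝ≥0 id

variable {C}

variable [TopologicalSpace C]

/-- In a weakly locally convex topological cone, the barycenter map is continuous. -/
theorem exists_isOpen_simpleValuation_mem_iff (hC : IsTopologicalCone C)
    (hW : IsWeaklyLocallyConvex C) {V : Set C} (hV : IsOpen V) :
    ∃ W : Set (UpperPi (Opens C)), IsOpen W ∧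
      ∀ ν, simpleValuation C ν ∈ W ↔ barycenter C ν ∈ V := by
  classical
  have key : ∀ ν, barycenter C ν ∈ V → ∃ W : Set (UpperPi (Opens C)), IsOpen W ∧
      simpleValuation C ν ∈ W ∧ ∀ μ, simpleValuation C μ ∈ W → barycenter C μ ∈ V := by
    intro ν hν
    obtain ⟨r, O, hrO, hall⟩ := hC.exists_sum_smul_mem_of_lt hW ν.support ν
      (fun x hx => pos_iff_ne_zero.2 (Finsupp.mem_support_iff.1 hx)) hV hν
    have happly : ∀ (J : Finset C) (μ : C →₀ ℝ≥0), simpleValuation C μ (⨆ x ∈ J, O x) =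
        ((∑ y ∈ μ.support, if ∃ x ∈ J, y ∈ O x then μ y else 0 : ℝ≥0) : ℝ≥0∞) := by
      intro J μ
      rw [simpleValuation_apply]
      simp only [Opens.mem_iSup, exists_prop]
    -- One subbasic condition per nonempty `J`: together they are exactly the strict Hall condition.
    refine ⟨⋂ J ∈ ν.support.powerset.filter Finset.Nonempty,
      {f | ((∑ x ∈ J, r x : ℝ≥0) : ℝ≥0∞) < f (⨆ x ∈ J, O x)},
      isOpen_biInter_finset fun J _ => UpperPi.isOpen_lt_apply _ _, ?_, fun μ hμ => ?_⟩
    · refine Set.mem_iInter₂.2 fun J hJ => ?_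
      rw [Finset.mem_filter, Finset.mem_powerset] at hJ
      rw [Set.mem_ofPred_eq, happly, ENNReal.coe_lt_coe]
      calc ∑ x ∈ J, r x < ∑ x ∈ J, ν x :=
            Finset.sum_lt_sum_of_nonempty hJ.2 fun x hx => (hrO x (hJ.1 hx)).1
        _ = ∑ x ∈ J, if ∃ z ∈ J, x ∈ O z then ν x else 0 :=
            Finset.sum_congr rfl fun x hx => (if_pos ⟨x, hx, (hrO x (hJ.1 hx)).2⟩).symm
        _ ≤ _ := Finset.sum_le_sum_of_subset hJ.1
    · refine hall μ.support μ fun J hJ hne => ?_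
      have := Set.mem_iInter₂.1 hμ J
        (Finset.mem_filter.2 ⟨Finset.mem_powerset.2 hJ, hne⟩)
      rw [Set.mem_ofPred_eq, happly, ENNReal.coe_lt_coe] at this
      convert this
  choose! W hWo hνW hWV using key
  refine ⟨⋃ ν ∈ {ν | barycenter C ν ∈ V}, W ν, isOpen_biUnion hWo, fun μ => ⟨fun h => ?_,
    fun h => Set.mem_biUnion (show μ ∈ {ν | barycenter C ν ∈ V} from h) (hνW μ h)⟩⟩
  obtain ⟨ν, hν, hμ⟩ := Set.mem_iUnion₂.1 h
  exact hWV ν hν μ hμ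

end Barycenter

/-! ### Construction of the retraction. -/

theorem IsTopologicalCone.continuous_add_right {C : Type u} [AddCommMonoid C] [Module ℝ≥0 C]
    [TopologicalSpace C] (hC : IsTopologicalCone C) (z : C) : Continuous fun y : C => y + z :=
  hC.continuous_add.comp (continuous_id.prodMk continuous_const)

theorem IsTopologicalCone.continuous_add_left {C : Type u} [AddCommMonoid C] [Module ℝ≥0 C]
    [TopologicalSpace C] (hC : IsTopologicalCone C) (z : C) : Continuous fun y : C => z + y :=
  hC.continuous_add.comp (continuous_const.prodMk continuous_id)

theorem IsTopologicalCone.continuous_const_smul {C : Type u} [AddCommMonoid C] [Module ℝ≥0 C]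
    [TopologicalSpace C] (hC : IsTopologicalCone C) (c : ℝ≥0) : Continuous fun y : C => c • y :=
  hC.continuous_smul.comp
    (f := fun y : C => (Topology.WithUpper.toUpper c, y)) (by fun_prop)

/-- Continuous maps to a `T₀` space are determined by their values on a Skula-dense set. -/
theorem UpperPi.eq_of_eqOn_skulaDense {ι : Type u} {X P : Set (UpperPi ι)}
    (hP : P ⊆ UpperPi.skulaClosure X) (hXP : X ⊆ P) {Y : Type*} [TopologicalSpace Y] [T0Space Y]
    {f g : P → Y} (hf : Continuous f) (hg : Continuous g)
    (h : ∀ x (hx : x ∈ X), f ⟨x, hXP hx⟩ = g ⟨x, hXP hx⟩) (y : P) : f y = g y := by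
  have key : ∀ {f g : P → Y}, Continuous f → Continuous g →
      (∀ x (hx : x ∈ X), f ⟨x, hXP hx⟩ = g ⟨x, hXP hx⟩) → ∀ V : Set Y, IsOpen V →
        f y ∈ V → g y ∈ V := by
    intro f g hf hg h V hV hy
    obtain ⟨W, hW, hWf⟩ := hV.preimage hf
    obtain ⟨W', hW', hWg⟩ := hV.preimage hg
    have hyW : (y : UpperPi ι) ∈ W := by
      change y ∈ Subtype.val ⁻¹' W
      rw [hWf]
      exact hy
    -- A point of `X` below `y` carries membership from `f` to `g`; open sets being upper sets then
    -- returns it to `y`.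
    obtain ⟨x, hx, hxW, hxy⟩ := hP y.2 W hW hyW
    have hfx : f ⟨x, hXP hx⟩ ∈ V := by
      change _ ∈ f ⁻¹' V
      rw [← hWf]
      exact hxW
    rw [h x hx] at hfx
    have hxW' : x ∈ W' := by
      change (⟨x, hXP hx⟩ : P) ∈ Subtype.val ⁻¹' W'
      rw [hWg]
      exact hfx
    change y ∈ g ⁻¹' V
    rw [← hWg]
    exact UpperPi.mem_of_le_of_isOpen hW' hxW' hxy
  exact (inseparable_iff_forall_isOpen.2 fun V hV =>
    ⟨key hf hg h V hV, key hg hf (fun x hx => (h x hx).symm) V hV⟩).eq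

section Retract

variable {C : Type u} [AddCommMonoid C] [Module ℝ≥0 C] [TopologicalSpace C]

/-- A cone between the simple valuations and their Skula closure to which the barycenter map
extends pointwise retracts onto `C`. -/
theorem isContinuousLinearRetract_of_forall_exists (hC : IsTopologicalCone C)
    (hW : IsWeaklyLocallyConvex C) (P : Submodule ℝ≥0 (UpperPi (Opens C)))
    (hle : LinearMap.range (simpleValuation C) ≤ P)
    (hPle : P ≤ UpperPi.skulaSubmodule (LinearMap.range (simpleValuation C)))
    (hext : ∀ y ∈ P, ∃ c : C, ∀ V : Set C, IsOpen V →
      (c ∈ V ↔ ∃ ν, simpleValuation C ν ≤ y ∧ barycenter C ν ∈ V)) :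
    IsContinuousLinearRetract C P := by
  classical
  have := hC.t0
  have hmem : ∀ ν, simpleValuation C ν ∈ P := fun ν => hle ⟨ν, rfl⟩
  choose! r₀ hr₀ using hext
  let r : P → C := fun y => r₀ y
  have hpre : ∀ V : Set C, IsOpen V → ∃ W : Set (UpperPi (Opens C)), IsOpen W ∧
      (∀ ν, simpleValuation C ν ∈ W ↔ barycenter C ν ∈ V) ∧
        ∀ y : P, r y ∈ V ↔ (y : UpperPi (Opens C)) ∈ W := by
    intro V hV
    obtain ⟨W, hWo, hWV⟩ := exists_isOpen_simpleValuation_mem_iff hC hW hV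
    refine ⟨W, hWo, hWV, fun y => (hr₀ y y.2 V hV).trans ⟨?_, fun hy => ?_⟩⟩
    · rintro ⟨ν, hνy, hν⟩
      exact UpperPi.mem_of_le_of_isOpen hWo ((hWV ν).2 hν) hνy
    · obtain ⟨_, ⟨ν, rfl⟩, hν, hνy⟩ := hPle y.2 W hWo hy
      exact ⟨ν, hνy, (hWV ν).1 hν⟩
  have hr : Continuous r := by
    refine continuous_def.2 fun V hV => ?_
    obtain ⟨W, hWo, -, hrW⟩ := hpre V hV
    convert hWo.preimage (continuous_subtype_val (p := fun y => y ∈ P)) using 1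
    ext y
    exact hrW y
  -- Since `C` is `T₀`, the barycenter depends only on the valuation, not on the weights
  -- representing it.
  have hrν : ∀ ν, r ⟨simpleValuation C ν, hmem ν⟩ = barycenter C ν := by
    refine fun ν => (inseparable_iff_forall_isOpen.2 fun V hV => ?_).eq
    obtain ⟨W, hWo, hWV, hrW⟩ := hpre V hV
    exact (hrW _).trans (hWV ν)
  have hPcone := UpperPi.isTopologicalCone_submodule P
  -- Additivity extends by density one variable at a time.
  have hadd₁ : ∀ (ν : C →₀ ℝ≥0) (y : P),
      r (y + ⟨simpleValuation C ν, hmem ν⟩) = r y + barycenter C ν := by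
    intro ν
    refine UpperPi.eq_of_eqOn_skulaDense hPle hle (hr.comp (hPcone.continuous_add_right _))
      ((hC.continuous_add_right _).comp hr) ?_
    rintro _ ⟨μ, rfl⟩
    have := hrν (μ + ν)
    simp only [map_add] at this
    change r _ = r ⟨simpleValuation C μ, hmem μ⟩ + _
    rw [hrν μ, ← this]
    rfl
  have hadd : ∀ y z : P, r (y + z) = r y + r z := by
    intro y
    refine UpperPi.eq_of_eqOn_skulaDense hPle hle (hr.comp (hPcone.continuous_add_left _))
      ((hC.continuous_add_left _).comp hr) ?_
    rintro _ ⟨ν, rfl⟩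
    change _ = r y + r ⟨simpleValuation C ν, hmem ν⟩
    rw [hrν]
    exact hadd₁ ν y
  have hsmul : ∀ (c : ℝ≥0) (y : P), r (c • y) = c • r y := by
    intro c
    refine UpperPi.eq_of_eqOn_skulaDense hPle hle (hr.comp (hPcone.continuous_const_smul _))
      ((hC.continuous_const_smul _).comp hr) ?_
    rintro _ ⟨ν, rfl⟩
    have := hrν (c • ν)
    simp only [map_smul] at this
    change r _ = c • r ⟨simpleValuation C ν, hmem ν⟩
    rw [hrν ν, ← this]
    rfl
  refine ⟨⟨⟨r, hadd⟩, hsmul⟩, fun x => ⟨simpleValuation C (Finsupp.single x 1), hmem _⟩, hr,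
    Continuous.subtype_mk (UpperPi.continuous_iff.2 fun U t => ?_) _, fun x => ?_⟩
  · by_cases ht : t < 1
    · convert U.isOpen using 1
      ext x
      by_cases hx : x ∈ U <;> simp [simpleValuation_single_apply, hx, ht]
    · convert isOpen_empty using 1
      ext x
      by_cases hx : x ∈ U <;> simp [simpleValuation_single_apply, hx, not_lt.1 ht]
  · exact (hrν _).trans (by simp [barycenter])

theorem IsWeaklyLocallyConvex.isContinuousLinearRetract_range (hC : IsTopologicalCone C)
    (hW : IsWeaklyLocallyConvex C) :
    IsContinuousLinearRetract C (LinearMap.range (simpleValuation C)) := by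
  refine isContinuousLinearRetract_of_forall_exists hC hW _ le_rfl
    (UpperPi.subset_skulaClosure _) ?_
  rintro _ ⟨μ, rfl⟩
  refine ⟨barycenter C μ, fun V hV => ⟨fun h => ⟨μ, le_rfl, h⟩, ?_⟩⟩
  rintro ⟨ν, hνμ, hν⟩
  obtain ⟨W, hWo, hWV⟩ := exists_isOpen_simpleValuation_mem_iff hC hW hV
  exact (hWV μ).1 (UpperPi.mem_of_le_of_isOpen hWo ((hWV ν).2 hν) hνμ)

/-- Two open sets met by barycenters of simple valuations below `y` pull back to open sets
containing `y`; Skula density gives one valuation below `y` in both. This is the irreducibility that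
sobriety of `C` needs. -/
theorem IsWeaklyLocallyConvex.isContinuousLinearRetract_skulaSubmodule
    (hC : IsTopologicalCone C) (hW : IsWeaklyLocallyConvex C) (hS : IsSober C) :
    IsContinuousLinearRetract C
      (UpperPi.skulaSubmodule (LinearMap.range (simpleValuation C))) := by
  have := hS.2
  refine isContinuousLinearRetract_of_forall_exists hC hW _
    (UpperPi.subset_skulaClosure _) le_rfl fun y hy => ?_
  have hirr : IsIrreducible (barycenter C '' {ν | simpleValuation C ν ≤ y}) := by
    refine ⟨⟨_, 0, ?_, rfl⟩, ?_⟩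
    · rw [Set.mem_ofPred_eq, map_zero]
      exact fun U => (zero_le : 0 ≤ y U)
    · rintro V₁ V₂ hV₁ hV₂ ⟨_, ⟨ν₁, hν₁y, rfl⟩, hν₁⟩ ⟨_, ⟨ν₂, hν₂y, rfl⟩, hν₂⟩
      obtain ⟨W₁, hW₁, hWV₁⟩ := exists_isOpen_simpleValuation_mem_iff hC hW hV₁
      obtain ⟨W₂, hW₂, hWV₂⟩ := exists_isOpen_simpleValuation_mem_iff hC hW hV₂
      obtain ⟨_, ⟨ν, rfl⟩, hν, hνy⟩ := hy (W₁ ∩ W₂) (hW₁.inter hW₂)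
        ⟨UpperPi.mem_of_le_of_isOpen hW₁ ((hWV₁ _).2 hν₁) hν₁y,
          UpperPi.mem_of_le_of_isOpen hW₂ ((hWV₂ _).2 hν₂) hν₂y⟩
      exact ⟨_, ⟨ν, hνy, rfl⟩, (hWV₁ ν).1 hν.1, (hWV₂ ν).1 hν.2⟩
  obtain ⟨c, hc⟩ := QuasiSober.sober hirr.closure isClosed_closure
  refine ⟨c, fun V hV => ?_⟩
  rw [hc.mem_open_set_iff hV, closure_inter_open_nonempty_iff hV]
  constructor
  · rintro ⟨_, ⟨ν, hνy, rfl⟩, hν⟩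
    exact ⟨ν, hνy, hν⟩
  · rintro ⟨ν, hνy, hν⟩
    exact ⟨_, ⟨ν, hνy, rfl⟩, hν⟩

end Retract

/-! ### Properties inherited by retracts. -/

section Converse

variable {C : Type u} [AddCommMonoid C] [Module ℝ≥0 C] [TopologicalSpace C]
  {D : Type u} [AddCommMonoid D] [Module ℝ≥0 D] [TopologicalSpace D]

theorem IsLocallyLinear.exists_isOpen_convex (hD : IsLocallyLinear D) {U : Set D}
    (hU : IsOpen U) {x : D} (hx : x ∈ U) :
    ∃ B ⊆ U, IsOpen B ∧ x ∈ B ∧ Convex ℝ≥0 B := by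
  obtain ⟨S, hS, ht⟩ := hD
  have hU' : TopologicalSpace.GenerateOpen S U := by
    subst ht
    exact hU
  induction hU' with
  | basic s hs => exact ⟨s, subset_rfl, (hS s hs).1, hx, (hS s hs).2.1⟩
  | univ => exact ⟨Set.univ, subset_rfl, isOpen_univ, trivial, convex_univ⟩
  | inter s t hs' ht' ihs iht =>
    have hgen : ∀ {s}, TopologicalSpace.GenerateOpen S s → IsOpen s := by
      subst ht
      exact id
    obtain ⟨A, hAs, hA, hxA, hAc⟩ := ihs (hgen hs') hx.1
    obtain ⟨B, hBt, hB, hxB, hBc⟩ := iht (hgen ht') hx.2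
    exact ⟨A ∩ B, Set.inter_subset_inter hAs hBt, hA.inter hB, ⟨hxA, hxB⟩, hAc.inter hBc⟩
  | sUnion T hT ih =>
    have hgen : ∀ {s}, TopologicalSpace.GenerateOpen S s → IsOpen s := by
      subst ht
      exact id
    obtain ⟨s, hs, hxs⟩ := hx
    obtain ⟨B, hBs, hB⟩ := ih s hs (hgen (hT s hs)) hxs
    exact ⟨B, hBs.trans (Set.subset_sUnion_of_mem hs), hB⟩

/-- The set `r '' B` is convex by linearity and contains the open set `s ⁻¹' B`, but need not be
open itself. -/
theorem IsContinuousLinearRetract.isWeaklyLocallyConvex (h : IsContinuousLinearRetract C D)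
    (hD : IsLocallyLinear D) : IsWeaklyLocallyConvex C := by
  obtain ⟨r, s, hr, hs, hrs⟩ := h
  intro x U hU hx
  obtain ⟨B, hBU, hB, hxB, hBc⟩ := hD.exists_isOpen_convex (hU.preimage hr) (x := s x)
    (by simpa [hrs] using hx)
  refine ⟨r '' B, Set.image_subset_iff.2 hBU, ?_, hBc.linear_image r⟩
  filter_upwards [(hB.preimage hs).mem_nhds hxB] with y hy
  exact ⟨s y, hy, hrs y⟩

/-- If `d` is generic in the closure of `s '' F`, then `r d` is generic in `F`. -/
theorem IsContinuousLinearRetract.quasiSober (h : IsContinuousLinearRetract C D)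
    [QuasiSober D] : QuasiSober C := by
  obtain ⟨r, s, hr, hs, hrs⟩ := h
  refine ⟨fun {F} hF hFc => ?_⟩
  obtain ⟨d, hd⟩ := QuasiSober.sober (hF.image s hs.continuousOn).closure isClosed_closure
  refine ⟨r d, Set.Subset.antisymm (closure_minimal ?_ hFc) fun x hx => ?_⟩
  · have hsub : closure (s '' F) ⊆ r ⁻¹' F :=
      closure_minimal (by rintro _ ⟨x, hx, rfl⟩; simpa [hrs] using hx) (hFc.preimage hr)
    exact Set.singleton_subset_iff.2 (hsub hd.mem)
  · have hx' : s x ∈ closure {d} := by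
      rw [hd.def]
      exact subset_closure ⟨x, hx, rfl⟩
    have := image_closure_subset_closure_image hr ⟨_, hx', rfl⟩
    simpa [hrs] using this

end Converse

theorem mainTheorem12 (C : Type u) [AddCommMonoid C] [Module ℝ≥0 C] [TopologicalSpace C]
    (hC : IsTopologicalCone C) :
    (IsWeaklyLocallyConvex C ↔
      ∃ (D : Type u) (_ : AddCommMonoid D) (_ : Module ℝ≥0 D) (_ : TopologicalSpace D),
        IsTopologicalCone D ∧ IsLocallyLinear D ∧ IsContinuousLinearRetract C D) ∧
    ((IsWeaklyLocallyConvex C ∧ IsSober C) ↔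
      ∃ (D : Type u) (_ : AddCommMonoid D) (_ : Module ℝ≥0 D) (_ : TopologicalSpace D),
        IsTopologicalCone D ∧ IsLocallyLinear D ∧ IsSober D ∧ IsContinuousLinearRetract C D) := by

  refine ⟨⟨fun hW => ?_, ?_⟩, ⟨?_, ?_⟩⟩
  · exact ⟨LinearMap.range (simpleValuation C), inferInstance, inferInstance, inferInstance,
      UpperPi.isTopologicalCone_submodule _, UpperPi.isLocallyLinear_submodule _,
      hW.isContinuousLinearRetract_range hC⟩
  · rintro ⟨D, _, _, _, -, hD, hr⟩
    exact hr.isWeaklyLocallyConvex hD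
  · rintro ⟨hW, hS⟩
    exact ⟨UpperPi.skulaSubmodule (LinearMap.range (simpleValuation C)), inferInstance,
      inferInstance, inferInstance, UpperPi.isTopologicalCone_submodule _,
      UpperPi.isLocallyLinear_submodule _, UpperPi.isSober_skulaClosure _,
      hW.isContinuousLinearRetract_skulaSubmodule hC hS⟩
  · rintro ⟨D, _, _, _, -, hD, hDS, hr⟩
    have := hDS.2
    exact ⟨hr.isWeaklyLocallyConvex hD, hC.t0, hr.quasiSober⟩
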